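/- Let $d\ge 2$ and $n\ge d+1$ be integers. A $d$-dimensional polytope in $\mathbb{R}^d$ is the convex hull $P$ of a finite set of points whose affine hull is $\mathbb{R}^d$; let $\mathcal{V}(P)$ denote its vertex set. A point $x\in\mathbb{R}^d\setminus P$ can be inserted in $P$ if the vertex set of $\mathrm{conv}(P\cup\{x\})$ is $\mathcal{V}(P)\cup\{x\}$; the insertion move then transforms $P$ into $\mathrm{conv}(P\cup\{x\})$. A vertex $v$ of $P$ can be deleted from $P$ if $\mathrm{conv}(\mathcal{V}(P)\setminus\{v\})$ is $d$-dimensional; the deletion move then transforms $P$ into $\mathrm{conv}(\mathcal{V}(P)\setminus\{v\})$. Let $\Gamma(d)$ be the graph whose vertices are all the $d$-dimensional polytopes in $\mathbb{R}^d$ and whose edges connect any two distinct polytopes such that one is obtained from the other by an insertion or a deletion move. Then the subgraph induced in $\Gamma(d)$ by the polytopes with $n$ or $n+1$ vertices is connected, its diameter is at least $4n-2d$ and at most $6n-2$, and any two polytopes with exactly $n$ vertices have distance at most $6n-4$ in this subgraph. -/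

import Mathlib

namespace PolytopeGraph

/-- A `d`-dimensional polytope contained in `ℝ^d`: the convex hull of finitely many points,
whose affine hull is the whole space. -/
structure Polytope (d : ℕ) where
  /-- The polytope, as a set of points. -/
  carrier : Set (EuclideanSpace ℝ (Fin d))
  isHull : ∃ S : Finset (EuclideanSpace ℝ (Fin d)), carrier = convexHull ℝ (S : Set _)
  fullDim : affineSpan ℝ carrier = ⊤

/-- The vertex set of a polytope: its set of extreme points. -/
def Polytope.vertices {d : ℕ} (P : Polytope d) : Set (EuclideanSpace ℝ (Fin d)) :=
  P.carrier.extremePoints ℝ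

/-- The number of vertices of a polytope (its vertex set is always finite). -/
noncomputable def Polytope.numVertices {d : ℕ} (P : Polytope d) : ℕ :=
  P.vertices.ncard

/-- A point `x` outside of `P` can be inserted in `P` if the vertex set of the convex hull of
`P ∪ {x}` consists of `x` and all the vertices of `P`. -/
def Polytope.CanInsert {d : ℕ} (P : Polytope d) (x : EuclideanSpace ℝ (Fin d)) : Prop :=
  x ∉ P.carrier ∧
    (convexHull ℝ (P.carrier ∪ {x})).extremePoints ℝ = P.vertices ∪ {x}

/-- A vertex `v` of `P` can be deleted from `P` if the convex hull of the other vertices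
is still `d`-dimensional. -/
def Polytope.CanDelete {d : ℕ} (P : Polytope d) (v : EuclideanSpace ℝ (Fin d)) : Prop :=
  v ∈ P.vertices ∧ affineSpan ℝ (convexHull ℝ (P.vertices \ {v})) = ⊤

/-- `Q` is obtained from `P` by an insertion move. -/
def IsInsertionMove {d : ℕ} (P Q : Polytope d) : Prop :=
  ∃ x, P.CanInsert x ∧ Q.carrier = convexHull ℝ (P.carrier ∪ {x})

/-- `Q` is obtained from `P` by a deletion move. -/
def IsDeletionMove {d : ℕ} (P Q : Polytope d) : Prop :=
  ∃ v, P.CanDelete v ∧ Q.carrier = convexHull ℝ (P.vertices \ {v})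

/-- The graph `Γ(d)` on the `d`-dimensional polytopes contained in `ℝ^d`: two distinct polytopes
are adjacent when one is obtained from the other by an insertion move or a deletion move. -/
def Gamma (d : ℕ) : SimpleGraph (Polytope d) :=
  SimpleGraph.fromRel fun P Q => IsInsertionMove P Q ∨ IsDeletionMove P Q

/-- The polytopes with `n` or `n + 1` vertices. -/
def level (d n : ℕ) : Set (Polytope d) :=
  {P | P.numVertices = n ∨ P.numVertices = n + 1}

/-- The subgraph induced in `Γ(d)` by the polytopes with `n` or `n + 1` vertices. -/
def GammaLevel (d n : ℕ) : SimpleGraph (level d n) :=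
  (Gamma d).induce (level d n)

end PolytopeGraph

/-! Two polytopes are adjacent exactly when their vertex sets differ by one point, and every finite
spanning subset of a convexly independent set is a vertex set. Inside such a set, moves are
therefore changes of subsets, and replacing one vertex costs an insertion followed by a deletion.

Upper bound: for P and Q with n vertices, let v in P and w in Q be vertices at maximal distance r. P
lies in the ball of radius r about w, with v on its boundary, so the vertices of P and a small
spherical cap around v are jointly in convex position (`exists_nhds_convexIndependent_union`). Since
v is already on the cap, n - 1 exchanges (`exists_edist_le_subset`) move P onto it. The same is done
with Q near w. The two caps are jointly in convex position, so n more exchanges connect them: 2(n-1)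
+ 2n + 2(n-1) = 6n - 4. A polytope with n + 1 vertices first loses one, whence 6n - 2.

Lower bound: P has n + 3 - d vertices on a convex arc and d - 2 transverse ones; Q has the opposite
arc and its own transverse vertices. Let R be the first polytope on a walk from P to Q with a vertex
on the opposite arc. It has n + 1 vertices, one of them on that arc, which forces at most two on the
original arc. Collinear transverse points limit the rest, so R shares few vertices with P and Q
together, and symmetric differences bound the length. -/

namespace PolytopeGraph

open scoped Topology symmDiff

/-! ### Convex position and extreme points. -/

section ConvexPosition

variable {E : Type*} [NormedAddCommGroup E] [NormedSpace ℝ E]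

theorem notMem_convexHull_of_mem_extremePoints {A s : Set E} {x : E} (hA : Convex ℝ A)
    (hx : x ∈ A.extremePoints ℝ) (hs : s ⊆ A) (hxs : x ∉ s) : x ∉ convexHull ℝ s := by
  intro h
  have hconv := (hA.mem_extremePoints_iff_convex_sdiff.1 hx).2
  have hsub : s ⊆ A \ {x} := fun y hy => ⟨hs hy, fun hyx => hxs (hyx ▸ hy)⟩
  exact (convexHull_min hsub hconv h).2 rfl

/-- By Krein–Milman the extreme points generate the hull; if x in `s` were not extreme, they would
lie in `s \ {x}`, whose hull would then contain x. -/
theorem extremePoints_convexHull_of_convexIndependent {s : Set E} (hs : s.Finite)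
    (hc : ConvexIndependent ℝ ((↑) : s → E)) : (convexHull ℝ s).extremePoints ℝ = s := by
  refine extremePoints_convexHull_subset.antisymm fun x hx => ?_
  by_contra hxe
  have hsub : (convexHull ℝ s).extremePoints ℝ ⊆ s \ {x} := fun y hy =>
    ⟨extremePoints_convexHull_subset hy, fun h => hxe (h ▸ hy)⟩
  have hcl : closure (convexHull ℝ ((convexHull ℝ s).extremePoints ℝ)) ⊆
      convexHull ℝ (s \ {x}) :=
    closure_minimal (convexHull_mono hsub) ((hs.sdiff).isClosed_convexHull ℝ)
  rw [closure_convexHull_extremePoints (hs.isCompact_convexHull ℝ) (convex_convexHull ℝ s)] at hcl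
  exact convexIndependent_set_iff_notMem_convexHull_sdiff.1 hc x hx
    (hcl (subset_convexHull ℝ s hx))

theorem convexIndependent_of_forall_exists_lt {s : Set E}
    (h : ∀ x ∈ s, ∃ f : E →ₗ[ℝ] ℝ, ∀ y ∈ s, y ≠ x → f x < f y) :
    ConvexIndependent ℝ ((↑) : s → E) := by
  rw [convexIndependent_set_iff_notMem_convexHull_sdiff]
  intro x hx hmem
  obtain ⟨f, hf⟩ := h x hx
  have hsub : s \ {x} ⊆ {y | f x < f y} := fun y hy => hf y hy.1 hy.2
  have hlt : f x < f x := convexHull_min hsub (convex_halfSpace_gt f.isLinear _) hmem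
  exact lt_irrefl _ hlt

theorem notMem_convexHull_of_subset {s t : Set E} (hc : ConvexIndependent ℝ ((↑) : s → E))
    {x : E} (hx : x ∈ s) (ht : t ⊆ s) (hxt : x ∉ t) : x ∉ convexHull ℝ t := by
  have hsub : t ⊆ s \ {x} := fun _ hy => ⟨ht hy, fun hyx => hxt (hyx ▸ hy)⟩
  exact fun h => convexIndependent_set_iff_notMem_convexHull_sdiff.1 hc x hx
    (convexHull_mono hsub h)

end ConvexPosition

/-! ### Moves in terms of vertex sets. -/

section Graph

variable {d n : ℕ}

local notation "𝔼" => EuclideanSpace ℝ (Fin d)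

theorem Polytope.finite_vertices (P : Polytope d) : P.vertices.Finite := by
  obtain ⟨S, hS⟩ := P.isHull
  refine S.finite_toSet.subset ?_
  rw [Polytope.vertices, hS]
  exact extremePoints_convexHull_subset

theorem Polytope.convex (P : Polytope d) : Convex ℝ P.carrier := by
  obtain ⟨S, hS⟩ := P.isHull
  rw [hS]
  exact convex_convexHull ℝ _

theorem Polytope.convexHull_vertices (P : Polytope d) :
    convexHull ℝ P.vertices = P.carrier := by
  obtain ⟨S, hS⟩ := P.isHull
  have hcomp : IsCompact P.carrier := by
    rw [hS]
    exact S.finite_toSet.isCompact_convexHull ℝ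
  have := closure_convexHull_extremePoints hcomp P.convex
  rwa [← Polytope.vertices, (P.finite_vertices.isClosed_convexHull ℝ).closure_eq] at this

theorem Polytope.ext_vertices {P Q : Polytope d} (h : P.vertices = Q.vertices) : P = Q := by
  have : P.carrier = Q.carrier := by
    rw [← P.convexHull_vertices, h, Q.convexHull_vertices]
  cases P
  cases Q
  congr

theorem Polytope.convexIndependent_vertices (P : Polytope d) :
    ConvexIndependent ℝ ((↑) : P.vertices → 𝔼) :=
  P.convex.convexIndependent_extremePoints

theorem Polytope.affineSpan_vertices (P : Polytope d) : affineSpan ℝ P.vertices = ⊤ := by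
  rw [← affineSpan_convexHull, P.convexHull_vertices, P.fullDim]

theorem exists_polytope_vertices_eq {s : Set 𝔼} (hs : s.Finite)
    (hc : ConvexIndependent ℝ ((↑) : s → 𝔼)) (ht : affineSpan ℝ s = ⊤) :
    ∃ P : Polytope d, P.vertices = s := by
  refine ⟨⟨convexHull ℝ s, ⟨hs.toFinset, by simp⟩, by rwa [affineSpan_convexHull]⟩, ?_⟩
  exact extremePoints_convexHull_of_convexIndependent hs hc

theorem gamma_adj_of_vertices_eq_insert {P Q : Polytope d} {x : 𝔼} (hx : x ∉ P.vertices)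
    (h : Q.vertices = insert x P.vertices) : (Gamma d).Adj P Q := by
  have hne : P ≠ Q := by
    rintro rfl
    exact hx (h ▸ Set.mem_insert _ _)
  have hcar : Q.carrier = convexHull ℝ (P.carrier ∪ {x}) := by
    rw [← P.convexHull_vertices, ← Q.convexHull_vertices, h, Set.union_singleton,
      Set.insert_eq, Set.insert_eq, convexHull_convexHull_union_right]
  refine (SimpleGraph.fromRel_adj _ _ _).2 ⟨hne, Or.inl (Or.inl ⟨x, ⟨?_, ?_⟩, hcar⟩)⟩
  · rw [← P.convexHull_vertices]
    exact notMem_convexHull_of_mem_extremePoints Q.convex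
      (show x ∈ Q.vertices from h ▸ Set.mem_insert _ _)
      (((Set.subset_insert _ _).trans h.symm.subset).trans extremePoints_subset) hx
  · rw [← hcar, Set.union_singleton]
    exact h

theorem vertices_eq_insert_of_gamma_adj {P Q : Polytope d} (h : (Gamma d).Adj P Q) :
    (∃ x, x ∉ P.vertices ∧ Q.vertices = insert x P.vertices) ∨
      ∃ x, x ∉ Q.vertices ∧ P.vertices = insert x Q.vertices := by
  have key : ∀ P Q : Polytope d, IsInsertionMove P Q ∨ IsDeletionMove P Q →
      (∃ x, x ∉ P.vertices ∧ Q.vertices = insert x P.vertices) ∨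
        ∃ x, x ∉ Q.vertices ∧ P.vertices = insert x Q.vertices := by
    rintro P Q (⟨x, ⟨hx, hext⟩, hQ⟩ | ⟨v, ⟨hv, -⟩, hQ⟩)
    · refine Or.inl ⟨x, fun h => hx (extremePoints_subset h), ?_⟩
      rw [Polytope.vertices, hQ, hext, Set.union_singleton]
    · have hQv : Q.vertices = P.vertices \ {v} := by
        rw [Polytope.vertices, hQ]
        exact extremePoints_convexHull_of_convexIndependent P.finite_vertices.sdiff
          (P.convexIndependent_vertices.mono Set.sdiff_subset)
      refine Or.inr ⟨v, by simp [hQv], ?_⟩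
      rw [hQv, Set.insert_sdiff_singleton, Set.insert_eq_of_mem hv]
  rcases ((SimpleGraph.fromRel_adj _ _ _).1 h).2 with h | h
  · exact key P Q h
  · exact (key Q P h).symm

theorem edist_le_one_of_vertices_eq_insert {P Q : level d n} {x : 𝔼} (hx : x ∉ P.1.vertices)
    (h : Q.1.vertices = insert x P.1.vertices) : (GammaLevel d n).edist P Q ≤ 1 :=
  SimpleGraph.edist_le_one_iff_adj_or_eq.2
    (Or.inl (SimpleGraph.induce_adj.2 (gamma_adj_of_vertices_eq_insert hx h)))

end Graph

/-! ### Spherical caps: spanning and convex position. -/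

section Sphere

variable {E : Type*} [NormedAddCommGroup E] [InnerProductSpace ℝ E]

open scoped RealInnerProductSpace

theorem affineSpan_sphere_inter_eq_top [FiniteDimensional ℝ E] (hE : 2 ≤ Module.finrank ℝ E) {v w : E} (hvw : v ≠ w)
    {U : Set E} (hU : U ∈ 𝓝 v) :
    affineSpan ℝ (Metric.sphere w (dist v w) ∩ U) = ⊤ := by
  set S := Metric.sphere w (dist v w) ∩ U with hS
  set a := v - w with ha
  have ha0 : a ≠ 0 := sub_ne_zero.2 hvw
  have hvS : v ∈ S := ⟨by simp [dist_eq_norm], mem_of_mem_nhds hU⟩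
  obtain ⟨f, hfa, hf0⟩ : ∃ f ∈ (ℝ ∙ a)ᗮ, f ≠ 0 := by
    refine Submodule.exists_mem_ne_zero_of_ne_bot fun h => ?_
    rw [Submodule.orthogonal_eq_bot_iff] at h
    have := finrank_span_singleton (K := ℝ) ha0
    rw [h, finrank_top] at this
    omega
  have haf : ⟪a, f⟫ = 0 := Submodule.mem_orthogonal_singleton_iff_inner_right.1 hfa
  -- `φ y` is the second intersection of the sphere with the line through `v` in direction `y`. The
  -- tangent direction `f` gives `v` itself, so directions near `f` give points in `U`; the
  -- non-tangent ones form a nonempty open set inside the direction space.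
  let φ : E → E := fun y => v + (-2 * ⟪a, y⟫ / ‖y‖ ^ 2) • y
  have hφf : φ f = v := by simp [φ, haf]
  have hφc : ContinuousAt φ f := by
    have : ‖f‖ ^ 2 ≠ 0 := by simpa using hf0
    fun_prop (disch := assumption)
  have hφs : ∀ y, y ≠ 0 → φ y ∈ Metric.sphere w (dist v w) := by
    intro y hy
    have hy' : ‖y‖ ^ 2 ≠ 0 := by simpa using hy
    have h1 : φ y - w = a + (-2 * ⟪a, y⟫ / ‖y‖ ^ 2) • y := by
      simp only [φ, ha]
      abel
    have h2 : ‖φ y - w‖ ^ 2 = ‖a‖ ^ 2 := by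
      rw [h1, norm_add_sq_real, inner_smul_right, norm_smul, mul_pow, Real.norm_eq_abs, sq_abs]
      field_simp
      ring
    rw [mem_sphere_iff_norm, dist_eq_norm]
    exact (sq_eq_sq₀ (norm_nonneg _) (norm_nonneg _)).1 h2
  have hN : {y | φ y ∈ U ∧ y ≠ 0} ∈ 𝓝 f :=
    Filter.inter_mem (hφc.preimage_mem_nhds (by rwa [hφf])) (isOpen_ne.mem_nhds hf0)
  set N := interior {y | φ y ∈ U ∧ y ≠ 0} with hNdef
  have hfN : N ∈ 𝓝 f := interior_mem_nhds.2 hN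
  obtain ⟨t, htN, ht0⟩ : ∃ t : ℝ, f + t • a ∈ N ∧ t ≠ 0 := by
    have hc : ContinuousAt (fun t : ℝ => f + t • a) 0 := by fun_prop
    have h1 : ∀ᶠ t : ℝ in 𝓝[≠] 0, f + t • a ∈ N :=
      nhdsWithin_le_nhds (hc.preimage_mem_nhds (by simpa using hfN))
    exact (h1.and self_mem_nhdsWithin).exists
  have hO : IsOpen (N ∩ {y | ⟪a, y⟫ ≠ 0}) :=
    isOpen_interior.inter (isOpen_ne_fun (by fun_prop) (by fun_prop))
  have hsub : N ∩ {y | ⟪a, y⟫ ≠ 0} ⊆ (vectorSpan ℝ S : Set E) := by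
    rintro y ⟨hyN, hya⟩
    obtain ⟨hyU, hy0⟩ := interior_subset hyN
    have h1 : φ y -ᵥ v ∈ vectorSpan ℝ S :=
      vsub_mem_vectorSpan ℝ ⟨hφs y hy0, hyU⟩ hvS
    have h2 : φ y -ᵥ v = (-2 * ⟪a, y⟫ / ‖y‖ ^ 2) • y := by simp [φ]
    rw [h2] at h1
    refine (Submodule.smul_mem_iff _ ?_).1 h1
    exact div_ne_zero (mul_ne_zero (by norm_num) hya) (by simpa using hy0)
  have htop : vectorSpan ℝ S = ⊤ := by
    refine Submodule.eq_top_of_nonempty_interior' _ ⟨f + t • a, ?_⟩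
    refine interior_maximal hsub hO ⟨htN, ?_⟩
    simp [inner_add_right, inner_smul_right, haf, ht0, ha0]
  exact (AffineSubspace.affineSpan_eq_top_iff_vectorSpan_eq_top_of_nonempty ℝ E E ⟨v, hvS⟩).2 htop

theorem infinite_sphere_inter [FiniteDimensional ℝ E] (hE : 2 ≤ Module.finrank ℝ E) {v w : E} (hvw : v ≠ w)
    {U : Set E} (hU : U ∈ 𝓝 v) : (Metric.sphere w (dist v w) ∩ U).Infinite := by
  intro hfin
  set S := Metric.sphere w (dist v w) ∩ U with hS
  -- Removing the finitely many other points leaves a neighbourhood meeting the sphere only in `v`,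
  -- which cannot span.
  have hU' : U ∩ (S \ {v})ᶜ ∈ 𝓝 v :=
    Filter.inter_mem hU (hfin.sdiff.isClosed.isOpen_compl.mem_nhds (by simp))
  have htop := affineSpan_sphere_inter_eq_top hE hvw hU'
  have hsub : Metric.sphere w (dist v w) ∩ (U ∩ (S \ {v})ᶜ) ⊆ {v} := by
    rintro x ⟨hx, hxU, hxS⟩
    by_contra hxv
    exact hxS ⟨⟨hx, hxU⟩, hxv⟩
  have h1 : w ∈ affineSpan ℝ ({v} : Set E) := by
    have := affineSpan_mono ℝ hsub
    rw [htop] at this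
    exact this (AffineSubspace.mem_top ℝ E w)
  exact hvw ((AffineSubspace.mem_affineSpan_singleton ℝ E).1 h1).symm

/-- Points of the sphere are extreme in the ball, which contains everything. A point p ≠ v of `s` is
strictly separated from the rest of `s`, including `v`, by a hyperplane; `U` is the intersection of
these finitely many open half-spaces. -/
theorem exists_nhds_convexIndependent_union {s : Set E} (hs : s.Finite)
    (hc : ConvexIndependent ℝ ((↑) : s → E)) {v w : E} (hv : v ∈ s) (hvw : v ≠ w)
    (hsw : s ⊆ Metric.closedBall w (dist v w)) :
    ∃ U ∈ 𝓝 v, ConvexIndependent ℝ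
      ((↑) : (s ∪ Metric.sphere w (dist v w) ∩ U : Set E) → E) := by
  have key : ∀ p ∈ s, ∃ f : E → ℝ, ∃ u : ℝ, Convex ℝ {z | f z < u} ∧ u < f p ∧
      (∀ z ∈ s, z ≠ p → f z < u) ∧ (p ≠ v → {z | f z < u} ∈ 𝓝 v) := by
    intro p hp
    obtain ⟨f, u, hf, hu⟩ := geometric_hahn_banach_closed_point
      (convex_convexHull ℝ (s \ {p})) (hs.sdiff.isClosed_convexHull ℝ)
      (convexIndependent_set_iff_notMem_convexHull_sdiff.1 hc p hp)
    have hf' : ∀ z ∈ s, z ≠ p → f z < u := fun z hz hzp =>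
      hf z (subset_convexHull ℝ _ ⟨hz, hzp⟩)
    refine ⟨f, u, convex_halfSpace_lt f.toLinearMap.isLinear u, hu, hf', fun hpv => ?_⟩
    exact (isOpen_lt f.continuous continuous_const).mem_nhds (hf' v hv hpv.symm)
  choose! f u hconv hu hlt hnhds using key
  have hr : dist v w ≠ 0 := dist_ne_zero.2 hvw
  refine ⟨⋂ p ∈ s \ {v}, {z | f p z < u p},
    (Filter.biInter_mem hs.sdiff).2 fun p hp => hnhds p hp.1 hp.2, ?_⟩
  rw [convexIndependent_set_iff_notMem_convexHull_sdiff]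
  have hsphere : ∀ x ∈ Metric.sphere w (dist v w), x ∉ convexHull ℝ
      ((s ∪ Metric.sphere w (dist v w) ∩ ⋂ p ∈ s \ {v}, {z | f p z < u p}) \ {x}) := by
    intro x hx
    refine notMem_convexHull_of_mem_extremePoints (convex_closedBall w (dist v w))
      (StrictConvexSpace.sphere_subset_extremePoints_closedBall w hr hx) ?_ (by simp)
    rintro z ⟨hz | hz, -⟩
    · exact hsw hz
    · exact Metric.sphere_subset_closedBall hz.1
  rintro x (hx | hx)
  · by_cases hxv : x = v
    · exact hsphere x (by simp [hxv, dist_eq_norm])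
    · intro h
      refine (hu x hx).not_gt (convexHull_min ?_ (hconv x hx) h)
      rintro z ⟨hz | hz, hzx⟩
      · exact hlt x hx z hz hzx
      · exact Set.mem_iInter₂.1 hz.2 x ⟨hx, hxv⟩
  · exact hsphere x hx.1

end Sphere

/-! ### Exchanging vertices while remaining full-dimensional. -/

section Exchange

variable {d n : ℕ}

local notation "𝔼" => EuclideanSpace ℝ (Fin d)

theorem affineSpan_insert_eq_top_of_notMem {V : Type*} [AddCommGroup V] [Module ℝ V]
    {s : Set V} {x y : V} (hs : s.Nonempty) (hy : affineSpan ℝ (insert y s) = ⊤)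
    (hx : x ∉ affineSpan ℝ s) : affineSpan ℝ (insert x s) = ⊤ := by
  obtain ⟨p, hp⟩ := hs
  have hpx : p ∈ insert x s := Set.mem_insert_of_mem _ hp
  have hle : affineSpan ℝ s ≤ affineSpan ℝ (insert x s) :=
    affineSpan_mono ℝ (Set.subset_insert _ _)
  have hps : p ∈ affineSpan ℝ s := subset_affineSpan ℝ s hp
  have hy' : y ∈ affineSpan ℝ (insert x s) := by
    have hxy : x ∈ affineSpan ℝ (insert y (affineSpan ℝ s : Set V)) := by
      rw [affineSpan_insert_affineSpan, hy]
      exact AffineSubspace.mem_top ℝ V x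
    obtain ⟨r, q, hq, hr⟩ := (AffineSubspace.mem_affineSpan_insert_iff hps y x).1 hxy
    have hr0 : r ≠ 0 := by
      rintro rfl
      exact hx (by simpa [hr] using hq)
    rw [← affineSpan_insert_affineSpan, AffineSubspace.mem_affineSpan_insert_iff hps]
    -- Solves x = r(y - p) + q for y.
    refine ⟨r⁻¹, AffineMap.lineMap p q (-r⁻¹), AffineMap.lineMap_mem _ hps hq, ?_⟩
    rw [hr]
    simp only [vsub_eq_sub, vadd_eq_add, AffineMap.lineMap_apply]
    match_scalars <;> field_simp <;> ring
  rw [eq_top_iff, ← hy]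
  refine affineSpan_le.2 (Set.insert_subset hy' ?_)
  exact (subset_affineSpan ℝ s).trans hle

/-- Affine Steinitz exchange. If `A` without `y` still spans, any point of `K` outside `A` works,
and counting provides one; otherwise any point of `K` outside the span of the remaining points does.
-/
theorem exists_exchange {V : Type*} [AddCommGroup V] [Module ℝ V] [DecidableEq V]
    {K : Set V} {A : Finset V} (h2 : 2 ≤ A.card)
    (hA : affineSpan ℝ (A : Set V) = ⊤) (hK : affineSpan ℝ K = ⊤) (hcard : A.card ≤ K.encard)
    {y : V} (hy : y ∈ A) (hyK : y ∉ K) :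
    ∃ x ∈ K, x ∉ A ∧ affineSpan ℝ ((insert x (A.erase y) : Finset V) : Set V) = ⊤ := by
  by_cases h : affineSpan ℝ ((A.erase y : Finset V) : Set V) = ⊤
  · obtain ⟨x, hxK, hxA⟩ : ∃ x ∈ K, x ∉ A := by
      by_contra! hcon
      have hsub : K ⊆ ((A.erase y : Finset V) : Set V) := fun x hx =>
        Finset.mem_coe.2 (Finset.mem_erase.2 ⟨fun hxy => hyK (hxy ▸ hx), hcon x hx⟩)
      have h1 := hcard.trans (Set.encard_le_encard hsub)
      rw [Set.encard_coe_eq_coe_finsetCard, Nat.cast_le, Finset.card_erase_of_mem hy] at h1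
      omega
    refine ⟨x, hxK, hxA, ?_⟩
    rw [eq_top_iff, ← h]
    exact affineSpan_mono ℝ (by simp)
  · obtain ⟨x, hxK, hx⟩ : ∃ x ∈ K, x ∉ affineSpan ℝ ((A.erase y : Finset V) : Set V) := by
      by_contra! hcon
      refine h ?_
      rw [eq_top_iff, ← hK]
      exact affineSpan_le.2 hcon
    refine ⟨x, hxK, fun hxA => hx (subset_affineSpan ℝ _ ?_), ?_⟩
    · exact Finset.mem_coe.2 (Finset.mem_erase.2 ⟨fun hxy => hyK (hxy ▸ hxK), hxA⟩)
    · rw [Finset.coe_insert]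
      refine affineSpan_insert_eq_top_of_notMem (y := y) ?_ ?_ hx
      · rw [Finset.coe_nonempty, ← Finset.card_pos, Finset.card_erase_of_mem hy]
        omega
      · rwa [← Finset.coe_insert, Finset.insert_erase hy]

/-- Each exchange passes through n + 1 vertices and lowers by at least one the number of vertices
outside `K`; those already in `K` are never removed. -/
theorem exists_edist_le_subset (hn : 2 ≤ n) {C K : Set 𝔼}
    (hC : ConvexIndependent ℝ ((↑) : C → 𝔼)) (hKC : K ⊆ C) (hK : affineSpan ℝ K = ⊤)
    (hcard : n ≤ K.encard) (m : ℕ) (P : level d n) (A : Finset 𝔼) (hPA : P.1.vertices = A)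
    (hAn : A.card = n) (hAC : ↑A ⊆ C) (hm : ((A : Set 𝔼) \ K).ncard ≤ m) :
    ∃ Q : level d n, ∃ B : Finset 𝔼, Q.1.vertices = B ∧ B.card = n ∧ ↑B ⊆ K ∧
      (GammaLevel d n).edist P Q ≤ ((2 * m : ℕ) : ℕ∞) := by
  classical
  induction m generalizing P A with
  | zero =>
    refine ⟨P, A, hPA, hAn, ?_, by simp⟩
    rw [Nat.le_zero, Set.ncard_eq_zero (A.finite_toSet.sdiff)] at hm
    exact Set.sdiff_eq_empty.1 hm
  | succ m ih =>
    by_cases hAK : (A : Set 𝔼) ⊆ K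
    · exact ⟨P, A, hPA, hAn, hAK, by simp⟩
    obtain ⟨y, hyA, hyK⟩ := Set.not_subset.1 hAK
    rw [Finset.mem_coe] at hyA
    have hA : affineSpan ℝ (A : Set 𝔼) = ⊤ := hPA ▸ P.1.affineSpan_vertices
    obtain ⟨x, hxK, hxA, hspan⟩ := exists_exchange (hAn ▸ hn) hA hK (hAn ▸ hcard) hyA hyK
    have hRC : ((insert x A : Finset 𝔼) : Set 𝔼) ⊆ C := by
      rw [Finset.coe_insert]
      exact Set.insert_subset (hKC hxK) hAC
    have hQR : insert x (A.erase y) ⊆ insert x A := Finset.insert_subset_insert _ (A.erase_subset y)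
    obtain ⟨R, hR⟩ := exists_polytope_vertices_eq (insert x A : Finset 𝔼).finite_toSet
      (hC.mono hRC) (by
        rw [eq_top_iff, ← hA]
        exact affineSpan_mono ℝ (by simp))
    obtain ⟨Q, hQ⟩ := exists_polytope_vertices_eq (insert x (A.erase y) : Finset 𝔼).finite_toSet
      (hC.mono ((Finset.coe_subset.2 hQR).trans hRC)) hspan
    have hxy : x ∉ A.erase y := fun h => hxA (Finset.mem_of_mem_erase h)
    have hyx : y ∉ insert x (A.erase y) := by
      simp only [Finset.mem_insert, Finset.mem_erase, ne_eq, not_true_eq_false, false_and, or_false]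
      exact fun h => hyK (h ▸ hxK)
    have hQcard : (insert x (A.erase y)).card = n := by
      rw [Finset.card_insert_of_notMem hxy, Finset.card_erase_of_mem hyA]
      omega
    have hRl : R ∈ level d n := by
      right
      rw [Polytope.numVertices, hR, Set.ncard_coe_finset, Finset.card_insert_of_notMem hxA, hAn]
    have hQl : Q ∈ level d n := by
      left
      rw [Polytope.numVertices, hQ, Set.ncard_coe_finset, hQcard]
    have hPR : (GammaLevel d n).edist P ⟨R, hRl⟩ ≤ 1 :=
      edist_le_one_of_vertices_eq_insert (x := x) (by rw [hPA]; exact hxA)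
        (by rw [hPA]; simpa using hR)
    have hQR : (GammaLevel d n).edist ⟨Q, hQl⟩ ⟨R, hRl⟩ ≤ 1 :=
      edist_le_one_of_vertices_eq_insert (x := y) (by rw [hQ]; exact hyx) (by
        simp only [hQ, hR]
        rw [← Finset.coe_insert, Finset.insert_comm, Finset.insert_erase hyA])
    have hlt : (((insert x (A.erase y) : Finset 𝔼) : Set 𝔼) \ K).ncard ≤ m := by
      have : ((insert x (A.erase y) : Finset 𝔼) : Set 𝔼) \ K ⊂ (A : Set 𝔼) \ K := by
        refine ⟨?_, fun h => ?_⟩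
        · rintro z ⟨hz, hzK⟩
          rcases Finset.mem_insert.1 (Finset.mem_coe.1 hz) with rfl | hz
          · exact absurd hxK hzK
          · exact ⟨Finset.mem_of_mem_erase hz, hzK⟩
        · exact hyx (h ⟨hyA, hyK⟩).1
      have := Set.ncard_lt_ncard this A.finite_toSet.sdiff
      omega
    obtain ⟨Q', B, h1, h2, h3, h4⟩ := ih ⟨Q, hQl⟩ _ hQ hQcard
      ((Finset.coe_subset.2 ‹insert x (A.erase y) ⊆ insert x A›).trans hRC) hlt
    refine ⟨Q', B, h1, h2, h3, ?_⟩
    calc (GammaLevel d n).edist P Q'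
        ≤ (GammaLevel d n).edist P ⟨R, hRl⟩ + (GammaLevel d n).edist ⟨R, hRl⟩ ⟨Q, hQl⟩ +
          (GammaLevel d n).edist ⟨Q, hQl⟩ Q' :=
          (SimpleGraph.edist_triangle).trans
            (add_le_add_left SimpleGraph.edist_triangle _)
      _ ≤ 1 + 1 + ((2 * m : ℕ) : ℕ∞) := by
          rw [SimpleGraph.edist_comm] at hQR
          gcongr
      _ = ((2 * (m + 1) : ℕ) : ℕ∞) := by
          push_cast
          ring

end Exchange

/-! ### The upper bounds. -/

section UpperBound

variable {d n : ℕ}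

local notation "𝔼" => EuclideanSpace ℝ (Fin d)

theorem Polytope.nontrivial_vertices (hd : 1 ≤ d) (P : Polytope d) : P.vertices.Nontrivial := by
  have : Nonempty (Fin d) := ⟨⟨0, hd⟩⟩
  rw [← Set.not_subsingleton_iff]
  intro h
  have h1 := P.affineSpan_vertices
  rcases h.eq_empty_or_singleton with h2 | ⟨x, h2⟩
  · rw [h2, AffineSubspace.span_empty] at h1
    exact AffineSubspace.bot_ne_top ℝ 𝔼 𝔼 h1
  · rw [h2] at h1
    obtain ⟨y, hy⟩ := exists_ne x
    exact hy ((AffineSubspace.mem_affineSpan_singleton ℝ 𝔼).1 (h1 ▸ AffineSubspace.mem_top ℝ 𝔼 y))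

theorem exists_edist_le_near_vertex (hd : 2 ≤ d) (hn : 2 ≤ n) (P : level d n)
    (hP : P.1.numVertices = n) {v w : 𝔼} (hv : v ∈ P.1.vertices) (hvw : v ≠ w)
    (hPw : P.1.vertices ⊆ Metric.closedBall w (dist v w)) {N : Set 𝔼} (hN : N ∈ 𝓝 v) :
    ∃ Q : level d n, Q.1.numVertices = n ∧ Q.1.vertices ⊆ Metric.sphere w (dist v w) ∩ N ∧
      (GammaLevel d n).edist P Q ≤ ((2 * (n - 1) : ℕ) : ℕ∞) := by
  have hE : 2 ≤ Module.finrank ℝ 𝔼 := by simpa using hd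
  have hfin := P.1.finite_vertices
  obtain ⟨U, hU, hC⟩ := exists_nhds_convexIndependent_union hfin
    P.1.convexIndependent_vertices hv hvw hPw
  have hUN : U ∩ N ∈ 𝓝 v := Filter.inter_mem hU hN
  have hvK : v ∈ Metric.sphere w (dist v w) ∩ (U ∩ N) :=
    ⟨by simp [dist_eq_norm], mem_of_mem_nhds hUN⟩
  have hcard : hfin.toFinset.card = n :=
    (Set.ncard_eq_toFinset_card _ hfin).symm.trans hP
  obtain ⟨Q, B, hQ, hB, hBK, hdist⟩ := exists_edist_le_subset hn
    (C := P.1.vertices ∪ Metric.sphere w (dist v w) ∩ (U ∩ N))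
    (K := Metric.sphere w (dist v w) ∩ (U ∩ N))
    (hC.mono (Set.union_subset_union_right _
      (Set.inter_subset_inter_right _ Set.inter_subset_left)))
    Set.subset_union_right (affineSpan_sphere_inter_eq_top hE hvw hUN)
    (by rw [(infinite_sphere_inter hE hvw hUN).encard_eq]; exact le_top) (n - 1) P hfin.toFinset
    (by simp) hcard (by simp) (by
      have hsub : (hfin.toFinset : Set 𝔼) \ (Metric.sphere w (dist v w) ∩ (U ∩ N)) ⊆
          P.1.vertices \ {v} := by
        rintro z ⟨hz, hzK⟩
        exact ⟨by simpa using hz, fun h => hzK (h ▸ hvK)⟩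
      refine (Set.ncard_le_ncard hsub hfin.sdiff).trans ?_
      rw [Set.ncard_sdiff_singleton_of_mem hv, ← Polytope.numVertices, hP])
  refine ⟨Q, ?_, ?_, hdist⟩
  · rw [Polytope.numVertices, hQ, Set.ncard_coe_finset, hB]
  · rw [hQ]
    exact hBK.trans (Set.inter_subset_inter_right _ Set.inter_subset_right)

theorem edist_le_of_convexIndependent_union (hn : 2 ≤ n) (P Q : level d n)
    (hP : P.1.numVertices = n) (hQ : Q.1.numVertices = n)
    (hC : ConvexIndependent ℝ ((↑) : (P.1.vertices ∪ Q.1.vertices : Set 𝔼) → 𝔼)) :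
    (GammaLevel d n).edist P Q ≤ ((2 * n : ℕ) : ℕ∞) := by
  have hcard : P.1.finite_vertices.toFinset.card = n :=
    (Set.ncard_eq_toFinset_card _ P.1.finite_vertices).symm.trans hP
  obtain ⟨R, B, hR, hB, hBQ, hdist⟩ := exists_edist_le_subset hn hC Set.subset_union_right
    Q.1.affineSpan_vertices
    (by rw [← Q.1.finite_vertices.cast_ncard_eq, ← Polytope.numVertices, hQ]) n P
    P.1.finite_vertices.toFinset (by simp) hcard (by simp) (by
      refine (Set.ncard_le_ncard Set.sdiff_subset (Finset.finite_toSet _)).trans ?_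
      rw [Set.ncard_coe_finset, hcard])
  have hBQ' : (B : Set 𝔼) = Q.1.vertices := by
    refine Set.eq_of_subset_of_ncard_le hBQ ?_ Q.1.finite_vertices
    rw [Set.ncard_coe_finset, hB, ← Polytope.numVertices, hQ]
  have hRQ : R = Q := Subtype.ext (Polytope.ext_vertices (hR.trans hBQ'))
  -- The target set has exactly n points, so the polytope reached inside it is `Q`.
  rwa [hRQ] at hdist

/-- Both balls contain the whole union, and each point is extreme in one of them by strict
convexity. -/
theorem convexIndependent_union_of_subset_spheres {E : Type*} [NormedAddCommGroup E]
    [InnerProductSpace ℝ E] {v w : E} {r : ℝ} (hr : r ≠ 0) {s t : Set E}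
    (hs : s ⊆ Metric.sphere w r ∩ Metric.closedBall v r)
    (ht : t ⊆ Metric.sphere v r ∩ Metric.closedBall w r) :
    ConvexIndependent ℝ ((↑) : (s ∪ t : Set E) → E) := by
  rw [convexIndependent_set_iff_notMem_convexHull_sdiff]
  have key : ∀ c : E, s ∪ t ⊆ Metric.closedBall c r → ∀ x ∈ Metric.sphere c r,
      x ∉ convexHull ℝ ((s ∪ t) \ {x}) := fun c hc x hx =>
    notMem_convexHull_of_mem_extremePoints (convex_closedBall c r)
      (StrictConvexSpace.sphere_subset_extremePoints_closedBall c hr hx)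
      (Set.sdiff_subset.trans hc) (by simp)
  rintro x (hx | hx)
  · exact key w (Set.union_subset (fun z hz => Metric.sphere_subset_closedBall (hs hz).1)
      fun z hz => (ht hz).2) x (hs hx).1
  · exact key v (Set.union_subset (fun z hz => (hs hz).2)
      fun z hz => Metric.sphere_subset_closedBall (ht hz).1) x (ht hx).1

theorem edist_le_of_numVertices_eq (hd : 2 ≤ d) (hn : d + 1 ≤ n) (P Q : level d n)
    (hP : P.1.numVertices = n) (hQ : Q.1.numVertices = n) :
    (GammaLevel d n).edist P Q ≤ ((6 * n - 4 : ℕ) : ℕ∞) := by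
  have hPn := P.1.nontrivial_vertices (by omega)
  have hQn := Q.1.nontrivial_vertices (by omega)
  obtain ⟨⟨v, w⟩, ⟨hv, hw⟩, hmax⟩ := Set.exists_max_image (P.1.vertices ×ˢ Q.1.vertices)
    (fun p => dist p.1 p.2) (P.1.finite_vertices.prod Q.1.finite_vertices)
    (hPn.nonempty.prod hQn.nonempty)
  simp only [Set.mem_prod, and_imp, Prod.forall] at hv hw hmax
  have hvw : v ≠ w := by
    rintro rfl
    obtain ⟨z, hz, hzv⟩ := hPn.exists_ne v
    have := hmax z v hz hw
    rw [dist_self] at this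
    exact hzv (dist_le_zero.1 this)
  have hr : dist v w ≠ 0 := dist_ne_zero.2 hvw
  have hwv : dist w v = dist v w := dist_comm w v
  obtain ⟨P', hP'n, hP', hPP'⟩ := exists_edist_le_near_vertex hd (by omega) P hP hv hvw
    (fun z hz => hmax z w hz hw) (Metric.closedBall_mem_nhds v (dist_pos.2 hvw))
  obtain ⟨Q', hQ'n, hQ', hQQ'⟩ := exists_edist_le_near_vertex hd (by omega) Q hQ hw hvw.symm
    (fun z hz => by
      rw [Metric.mem_closedBall, hwv, dist_comm]
      exact hmax v z hv hz) (Metric.closedBall_mem_nhds w (dist_pos.2 hvw))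
  rw [hwv] at hQ'
  have hmid := edist_le_of_convexIndependent_union (by omega) P' Q' hP'n hQ'n
    (convexIndependent_union_of_subset_spheres hr hP' hQ')
  rw [SimpleGraph.edist_comm] at hQQ'
  calc (GammaLevel d n).edist P Q
      ≤ (GammaLevel d n).edist P P' + (GammaLevel d n).edist P' Q' +
        (GammaLevel d n).edist Q' Q :=
        SimpleGraph.edist_triangle.trans (add_le_add_left SimpleGraph.edist_triangle _)
    _ ≤ ((2 * (n - 1) : ℕ) : ℕ∞) + ((2 * n : ℕ) : ℕ∞) + ((2 * (n - 1) : ℕ) : ℕ∞) := by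
        gcongr
    _ = ((6 * n - 4 : ℕ) : ℕ∞) := by
        rw [← Nat.cast_add, ← Nat.cast_add]
        congr 1
        omega

/-- An affine basis chosen among the vertices has at most d + 1 ≤ n points, so among n + 1 vertices
some vertex outside it can be deleted. -/
theorem exists_numVertices_eq_edist_le_one (hn : d + 1 ≤ n) (P : level d n) :
    ∃ Q : level d n, Q.1.numVertices = n ∧ (GammaLevel d n).edist P Q ≤ 1 := by
  rcases P.2 with hP | hP
  · exact ⟨P, hP, by simp⟩
  obtain ⟨t, hts, htspan, hti⟩ := exists_affineIndependent ℝ 𝔼 P.1.vertices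
  obtain ⟨v, hvP, hvt⟩ : ∃ v ∈ P.1.vertices, v ∉ t := by
    by_contra! hcon
    have hPt : P.1.vertices = t := Set.Subset.antisymm hcon hts
    have hfin := P.1.finite_vertices
    have : Fintype t := (hPt ▸ hfin).fintype
    have h1 := hti.card_le_finrank_succ
    have h2 := Submodule.finrank_le (vectorSpan ℝ (Set.range ((↑) : t → 𝔼)))
    rw [finrank_euclideanSpace_fin] at h2
    have h3 : t.ncard = n + 1 := by rw [← hPt, ← Polytope.numVertices, hP]
    rw [← Nat.card_eq_fintype_card, Nat.card_coe_set_eq, h3] at h1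
    omega
  obtain ⟨Q, hQ⟩ := exists_polytope_vertices_eq (P.1.finite_vertices.sdiff (t := {v}))
    (P.1.convexIndependent_vertices.mono Set.sdiff_subset) (by
      rw [eq_top_iff, ← P.1.affineSpan_vertices, ← htspan]
      exact affineSpan_mono ℝ fun z hz => ⟨hts hz, fun h => hvt (h ▸ hz)⟩)
  have hQn : Q.numVertices = n := by
    rw [Polytope.numVertices, hQ, Set.ncard_sdiff_singleton_of_mem hvP, ← Polytope.numVertices, hP,
      Nat.add_sub_cancel]
  refine ⟨⟨Q, Or.inl hQn⟩, hQn, ?_⟩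
  rw [SimpleGraph.edist_comm]
  refine edist_le_one_of_vertices_eq_insert (x := v) (by rw [hQ]; simp) ?_
  rw [hQ, Set.insert_sdiff_singleton, Set.insert_eq_of_mem hvP]

theorem edist_le (hd : 2 ≤ d) (hn : d + 1 ≤ n) (P Q : level d n) :
    (GammaLevel d n).edist P Q ≤ ((6 * n - 2 : ℕ) : ℕ∞) := by
  obtain ⟨P', hP', hPP'⟩ := exists_numVertices_eq_edist_le_one hn P
  obtain ⟨Q', hQ', hQQ'⟩ := exists_numVertices_eq_edist_le_one hn Q
  have hmid := edist_le_of_numVertices_eq hd hn P' Q' hP' hQ'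
  rw [SimpleGraph.edist_comm] at hQQ'
  calc (GammaLevel d n).edist P Q
      ≤ (GammaLevel d n).edist P P' + (GammaLevel d n).edist P' Q' +
        (GammaLevel d n).edist Q' Q :=
        SimpleGraph.edist_triangle.trans (add_le_add_left SimpleGraph.edist_triangle _)
    _ ≤ ((1 : ℕ) : ℕ∞) + ((6 * n - 4 : ℕ) : ℕ∞) + ((1 : ℕ) : ℕ∞) := by
        gcongr <;> simpa
    _ = ((6 * n - 2 : ℕ) : ℕ∞) := by
        rw [← Nat.cast_add, ← Nat.cast_add]
        congr 1
        omega

end UpperBound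

/-! ### The two distant polytopes. -/

section Construction

variable {E κ : Type*} [NormedAddCommGroup E] [NormedSpace ℝ E]

/-- The point with coordinates `(t, 1 + t ^ 2)` in the plane of the first two vectors of `e`. -/
def parabolaPoint (e : Fin 2 ⊕ κ → E) (t : ℝ) : E :=
  t • e (.inl 0) + (1 + t ^ 2) • e (.inl 1)

/-- Points on a parabola, together with the vectors of `e` transverse to its plane. -/
def pyramidVertices (e : Fin 2 ⊕ κ → E) (T : Finset ℝ) : Set E :=
  parabolaPoint e '' T ∪ Set.range (fun j => e (.inr j))

theorem finite_pyramidVertices [Finite κ] (e : Fin 2 ⊕ κ → E) (T : Finset ℝ) :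
    (pyramidVertices e T).Finite :=
  (T.finite_toSet.image _).union (Set.finite_range _)

theorem convexIndependent_pyramidVertices (e : Module.Basis (Fin 2 ⊕ κ) ℝ E) (T : Finset ℝ) :
    ConvexIndependent ℝ ((↑) : pyramidVertices e T → E) := by
  classical
  refine convexIndependent_of_forall_exists_lt ?_
  rintro x (⟨t, -, rfl⟩ | ⟨j, rfl⟩)
  · refine ⟨e.constr ℝ (Sum.elim ![-2 * t, 1] fun _ => (2 : ℝ)), ?_⟩
    rintro y (⟨s, -, rfl⟩ | ⟨j, rfl⟩) hy
    · have hst : s ≠ t := fun h => hy (h ▸ rfl)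
      have : 0 < (s - t) ^ 2 := by
        have := sub_ne_zero.2 hst
        positivity
      simp only [parabolaPoint, map_add, map_smul, Module.Basis.constr_basis, Sum.elim_inl,
        Matrix.cons_val_zero, Matrix.cons_val_one, smul_eq_mul]
      linarith
    · simp only [parabolaPoint, map_add, map_smul, Module.Basis.constr_basis, Sum.elim_inl,
        Matrix.cons_val_zero, Matrix.cons_val_one, smul_eq_mul, Sum.elim_inr]
      nlinarith [sq_nonneg t]
  · refine ⟨-e.coord (.inr j), ?_⟩
    rintro y (⟨s, -, rfl⟩ | ⟨i, rfl⟩) hy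
    · simp [parabolaPoint]
    · have hij : i ≠ j := fun h => hy (h ▸ rfl)
      simp [hij]

theorem affineSpan_pyramidVertices (e : Module.Basis (Fin 2 ⊕ κ) ℝ E) {T : Finset ℝ}
    (hT : 2 < T.card) : affineSpan ℝ (pyramidVertices e T) = ⊤ := by
  obtain ⟨i, j, k, hi, hj, hk, hij, hik, hjk⟩ := Finset.two_lt_card_iff.1 hT
  set D := vectorSpan ℝ (pyramidVertices e T) with hD
  have hp : ∀ t ∈ T, parabolaPoint e t ∈ pyramidVertices e T := fun t ht => Or.inl ⟨t, ht, rfl⟩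
  have key : ∀ s ∈ T, s ≠ i → e (.inl 0) + (s + i) • e (.inl 1) ∈ D := by
    intro s hs hsi
    have h1 : parabolaPoint e s -ᵥ parabolaPoint e i ∈ D := vsub_mem_vectorSpan ℝ (hp s hs) (hp i hi)
    have h2 : parabolaPoint e s -ᵥ parabolaPoint e i =
        (s - i) • (e (.inl 0) + (s + i) • e (.inl 1)) := by
      simp only [parabolaPoint, vsub_eq_sub]
      module
    rw [h2] at h1
    exact (Submodule.smul_mem_iff _ (sub_ne_zero.2 hsi)).1 h1
  have h1 : e (.inl 1) ∈ D := by
    have h2 := D.sub_mem (key j hj hij.symm) (key k hk hik.symm)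
    have h3 : e (.inl 0) + (j + i) • e (.inl 1) - (e (.inl 0) + (k + i) • e (.inl 1)) =
        (j - k) • e (.inl 1) := by module
    rw [h3] at h2
    exact (Submodule.smul_mem_iff _ (sub_ne_zero.2 hjk)).1 h2
  have h0 : e (.inl 0) ∈ D := by
    have := D.sub_mem (key j hj hij.symm) (D.smul_mem (j + i) h1)
    rwa [add_sub_cancel_right] at this
  have hpi : parabolaPoint e i ∈ D := D.add_mem (D.smul_mem _ h0) (D.smul_mem _ h1)
  refine (AffineSubspace.affineSpan_eq_top_iff_vectorSpan_eq_top_of_nonempty ℝ E E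
    ⟨_, hp i hi⟩).2 ?_
  rw [eq_top_iff, ← e.span_eq, Submodule.span_le]
  rintro _ ⟨j | j, rfl⟩
  · fin_cases j
    · exact h0
    · exact h1
  · have := D.add_mem (vsub_mem_vectorSpan ℝ (Or.inr ⟨j, rfl⟩) (hp i hi)) hpi
    rwa [vsub_eq_sub, sub_add_cancel] at this

theorem ncard_pyramidVertices [Fintype κ] (e : Module.Basis (Fin 2 ⊕ κ) ℝ E) (T : Finset ℝ) :
    (pyramidVertices e T).ncard = T.card + Fintype.card κ := by
  have hp : Function.Injective (parabolaPoint e) := fun s t h => by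
    simpa [parabolaPoint, Finsupp.single_apply] using congrArg (e.coord (.inl 0)) h
  have hinj : Function.Injective fun j => e (.inr j) := e.injective.comp Sum.inr_injective
  have hdisj : Disjoint (parabolaPoint e '' T) (Set.range fun j => e (.inr j)) := by
    rw [Set.disjoint_left]
    rintro _ ⟨t, -, rfl⟩ ⟨j, hj⟩
    have := congrArg (e.coord (.inl 1)) hj
    simp [parabolaPoint] at this
    nlinarith [sq_nonneg t]
  rw [pyramidVertices, Set.ncard_union_eq hdisj (T.finite_toSet.image _) (Set.finite_range _),
    Set.ncard_image_of_injective _ hp, Set.ncard_coe_finset, ← Set.image_univ,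
    Set.ncard_image_of_injective _ hinj, Set.ncard_univ,
    Nat.card_eq_fintype_card]

theorem card_le_two_of_forall_lt {F : Finset ℝ}
    (h : ∀ i ∈ F, ∀ j ∈ F, ∀ k ∈ F, i < j → j < k → False) : F.card ≤ 2 := by
  by_contra! hF
  have hne : F.Nonempty := Finset.card_pos.1 (by omega)
  obtain ⟨j, hj, hjn⟩ := Finset.exists_mem_notMem_of_card_lt_card
    (s := {F.min' hne, F.max' hne}) (t := F) (Finset.card_le_two.trans_lt hF)
  simp only [Finset.mem_insert, Finset.mem_singleton, not_or] at hjn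
  exact h _ (F.min'_mem hne) j hj _ (F.max'_mem hne)
    ((F.min'_le j hj).lt_of_ne' hjn.1) ((F.le_max' j hj).lt_of_ne hjn.2)

theorem mem_convexHull_triple {x y z p : E} {a b c : ℝ} (ha : 0 ≤ a) (hb : 0 ≤ b) (hc : 0 ≤ c)
    (habc : 0 < a + b + c) (h : (a + b + c) • p = a • x + b • y + c • z) :
    p ∈ convexHull ℝ {x, y, z} := by
  have hp : p = (a / (a + b + c)) • x + (b / (a + b + c)) • y + (c / (a + b + c)) • z := by
    rw [← inv_smul_smul₀ habc.ne' p, h]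
    simp only [smul_add, smul_smul, div_eq_inv_mul]
  have hconv := convex_convexHull ℝ ({x, y, z} : Set E)
  rw [hp]
  have hsum := hconv.sum_mem (t := Finset.univ)
    (w := ![a / (a + b + c), b / (a + b + c), c / (a + b + c)]) (z := ![x, y, z])
    (by intro i _; fin_cases i <;> simp <;> positivity)
    (by simp [Fin.sum_univ_three]; field_simp)
    (by intro i _; fin_cases i <;> exact subset_convexHull ℝ _ (by simp))
  simpa [Fin.sum_univ_three] using hsum

/-- The opposite point lies on or below the secants of the parabola through i, j and through j, k.
This is `h1`, which reduces to (s + 1)² ≤ 2 + 2s²; the barycentric weights are the resulting signed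
areas. -/
theorem parabolaPoint_mem_convexHull {e : Fin 2 ⊕ κ → E} {i j k s : ℝ} (hi : 0 ≤ i) (hij : i < j)
    (hjk : j < k) (hk : k ≤ 1) (hs : 0 ≤ s) :
    parabolaPoint e j ∈
      convexHull ℝ {parabolaPoint e i, parabolaPoint e k, -parabolaPoint e s} := by
  have h1 : ∀ a b : ℝ, 0 ≤ a → a ≤ 1 → 0 ≤ b → b ≤ 1 → 0 ≤ 2 + 2 * s ^ 2 - (s + a) * (s + b) := by
    intro a b ha ha1 hb hb1
    have : (s + a) * (s + b) ≤ (s + 1) * (s + 1) := by gcongr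
    nlinarith [sq_nonneg (s - 1)]
  have hc : 0 < (j - i) * (k - j) * (k - i) :=
    mul_pos (mul_pos (by linarith) (by linarith)) (by linarith)
  have ha := mul_nonneg (sub_nonneg.2 hjk.le) (h1 j k (by linarith) (by linarith) (by linarith) hk)
  have hb := mul_nonneg (sub_nonneg.2 hij.le) (h1 i j hi (by linarith) (by linarith) (by linarith))
  refine mem_convexHull_triple ha hb hc.le (by linarith) ?_
  simp only [parabolaPoint]
  module

theorem card_filter_parabolaPoint_le_two {e : Fin 2 ⊕ κ → E} {W : Set E}
    (hW : ConvexIndependent ℝ ((↑) : W → E)) {T : Finset ℝ} (hT : ∀ t ∈ T, 0 ≤ t ∧ t ≤ 1)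
    (he : Function.Injective (parabolaPoint e)) {s : ℝ} (hs : 0 ≤ s)
    (hsW : -parabolaPoint e s ∈ W) (hse : ∀ t, parabolaPoint e t ≠ -parabolaPoint e s)
    [DecidablePred fun t => parabolaPoint e t ∈ W] :
    (T.filter fun t => parabolaPoint e t ∈ W).card ≤ 2 := by
  refine card_le_two_of_forall_lt fun i hi j hj k hk hij hjk => ?_
  rw [Finset.mem_filter] at hi hj hk
  refine notMem_convexHull_of_subset hW hj.2 (t := {parabolaPoint e i, parabolaPoint e k,
    -parabolaPoint e s}) ?_ ?_
    (parabolaPoint_mem_convexHull (hT i hi.1).1 hij hjk (hT k hk.1).2 hs)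
  · rintro z (rfl | rfl | rfl)
    exacts [hi.2, hk.2, hsW]
  · rintro (h | h | h)
    · exact hij.ne' (he h)
    · exact hjk.ne (he h)
    · exact hse j h

theorem card_filter_lineMap_le_two {W : Set E} (hW : ConvexIndependent ℝ ((↑) : W → E))
    {a b : E} (hab : a ≠ b) (F : Finset ℝ)
    [DecidablePred fun t : ℝ => AffineMap.lineMap a b t ∈ W] :
    (F.filter fun t => AffineMap.lineMap a b t ∈ W).card ≤ 2 := by
  have hinj := AffineMap.lineMap_injective ℝ hab
  refine card_le_two_of_forall_lt fun i hi j hj k hk hij hjk => ?_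
  rw [Finset.mem_filter] at hi hj hk
  refine notMem_convexHull_of_subset hW hj.2 (t := {AffineMap.lineMap a b i,
    AffineMap.lineMap a b k}) ?_ ?_ ?_
  · rintro z (rfl | rfl)
    exacts [hi.2, hk.2]
  · rintro (h | h)
    · exact hij.ne' (hinj h)
    · exact hjk.ne (hinj h)
  · rw [← Set.pair_eq_singleton (AffineMap.lineMap a b k)]
    refine mem_convexHull_triple (sub_nonneg.2 hjk.le) (sub_nonneg.2 hij.le) le_rfl
      (by linarith) ?_
    simp only [AffineMap.lineMap_apply_module]
    module

variable {k r : ℕ}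

/-- A family obtained from `e` by reflecting the plane of the first two vectors about the origin,
so that the transverse vectors paired by `Bool` stay on the same line. -/
def oppositeFamily (e : Fin 2 ⊕ (Fin k × Bool ⊕ Fin r) → E) :
    Fin 2 ⊕ (Fin k × Bool ⊕ Fin r) → E
  | .inl i => -e (.inl i)
  | .inr (.inl (i, b)) => (2 : ℝ) • e (.inr (.inl (i, b))) - e (.inr (.inl (i, !b)))
  | .inr (.inr l) => (2 : ℝ) • e (.inr (.inr l))

theorem parabolaPoint_oppositeFamily (e : Fin 2 ⊕ (Fin k × Bool ⊕ Fin r) → E) (t : ℝ) :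
    parabolaPoint (oppositeFamily e) t = -parabolaPoint e t := by
  simp only [parabolaPoint, oppositeFamily]
  module

theorem top_le_span_oppositeFamily
    (e : Module.Basis (Fin 2 ⊕ (Fin k × Bool ⊕ Fin r)) ℝ E) :
    ⊤ ≤ Submodule.span ℝ (Set.range (oppositeFamily e)) := by
  set D := Submodule.span ℝ (Set.range (oppositeFamily e))
  have h : ∀ j, oppositeFamily e j ∈ D := fun j => Submodule.subset_span ⟨j, rfl⟩
  rw [← e.span_eq, Submodule.span_le]
  rintro _ ⟨i | ⟨i, b⟩ | l, rfl⟩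
  · simpa [oppositeFamily] using D.neg_mem (h (.inl i))
  · have h1 := D.smul_mem (1 / 3 : ℝ)
      (D.add_mem (D.smul_mem (2 : ℝ) (h (.inr (.inl (i, b))))) (h (.inr (.inl (i, !b)))))
    have h2 : (1 / 3 : ℝ) • ((2 : ℝ) • oppositeFamily e (.inr (.inl (i, b))) +
        oppositeFamily e (.inr (.inl (i, !b)))) = e (.inr (.inl (i, b))) := by
      simp only [oppositeFamily, Bool.not_not]
      module
    rwa [h2] at h1
  · exact (Submodule.smul_mem_iff _ two_ne_zero).1 (h (.inr (.inr l)))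

/-- `oppositeFamily` of a basis, as a basis. -/
noncomputable def oppositeBasis (e : Module.Basis (Fin 2 ⊕ (Fin k × Bool ⊕ Fin r)) ℝ E) :
    Module.Basis (Fin 2 ⊕ (Fin k × Bool ⊕ Fin r)) ℝ E :=
  basisOfTopLeSpanOfCardEqFinrank (oppositeFamily e) (top_le_span_oppositeFamily e)
    (Module.finrank_eq_card_basis e).symm

theorem coe_oppositeBasis (e : Module.Basis (Fin 2 ⊕ (Fin k × Bool ⊕ Fin r)) ℝ E) :
    ⇑(oppositeBasis e) = oppositeFamily e :=
  coe_basisOfTopLeSpanOfCardEqFinrank _ _ _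

/-- Each pair and its opposite pair are four collinear points, at parameters -1, 0, 1, 2, of which a
set in convex position contains at most two. Each unpaired vector and its double contribute at most
two trivially. -/
theorem card_filter_transverse_le (e : Module.Basis (Fin 2 ⊕ (Fin k × Bool ⊕ Fin r)) ℝ E)
    {W : Set E} (hW : ConvexIndependent ℝ ((↑) : W → E)) [DecidablePred (· ∈ W)] :
    (Finset.univ.filter fun j => e (.inr j) ∈ W).card +
      (Finset.univ.filter fun j => oppositeFamily e (.inr j) ∈ W).card ≤ 2 * k + 2 * r := by
  rw [Finset.card_filter, Finset.card_filter, ← Finset.sum_add_distrib, Fintype.sum_sum_type,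
    Fintype.sum_prod_type]
  have hpair : ∀ i : Fin k, ∑ b : Bool, ((if e (.inr (.inl (i, b))) ∈ W then 1 else 0) +
      (if oppositeFamily e (.inr (.inl (i, b))) ∈ W then 1 else 0)) ≤ 2 := by
    intro i
    have hne : e (.inr (.inl (i, false))) ≠ e (.inr (.inl (i, true))) :=
      e.injective.ne (by simp)
    have h1 := card_filter_lineMap_le_two hW hne {-1, 0, 1, 2}
    rw [Finset.card_filter, Finset.sum_insert (by norm_num), Finset.sum_insert (by norm_num),
      Finset.sum_insert (by norm_num), Finset.sum_singleton] at h1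
    have h2 : AffineMap.lineMap (e (.inr (.inl (i, false)))) (e (.inr (.inl (i, true)))) (-1 : ℝ) =
        oppositeFamily e (.inr (.inl (i, false))) := by
      simp only [AffineMap.lineMap_apply_module, oppositeFamily, Bool.not_false]
      module
    have h3 : AffineMap.lineMap (e (.inr (.inl (i, false)))) (e (.inr (.inl (i, true)))) (2 : ℝ) =
        oppositeFamily e (.inr (.inl (i, true))) := by
      simp only [AffineMap.lineMap_apply_module, oppositeFamily, Bool.not_true]
      module
    rw [h2, h3, AffineMap.lineMap_apply_zero, AffineMap.lineMap_apply_one] at h1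
    rw [Fintype.sum_bool]
    omega
  refine add_le_add ((Finset.sum_le_sum fun i _ => hpair i).trans (by simp [mul_comm]))
    ((Finset.sum_le_sum (g := fun _ => 2) fun l _ => ?_).trans (by simp [mul_comm]))
  split_ifs <;> norm_num

theorem ncard_inter_pyramidVertices_le [Fintype κ] (e : Fin 2 ⊕ κ → E) (T : Finset ℝ) (W : Set E)
    [DecidablePred (· ∈ W)] :
    (W ∩ pyramidVertices e T).ncard ≤ (W ∩ parabolaPoint e '' T).ncard +
      (Finset.univ.filter fun j => e (.inr j) ∈ W).card := by
  classical
  rw [pyramidVertices, Set.inter_union_distrib_left]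
  refine (Set.ncard_union_le _ _).trans (Nat.add_le_add_left ?_ _)
  have hsub : W ∩ Set.range (fun j => e (.inr j)) ⊆
      ((Finset.univ.filter fun j => e (.inr j) ∈ W).image fun j => e (.inr j) : Finset E) := by
    rintro _ ⟨hW, j, rfl⟩
    exact Finset.mem_coe.2 (Finset.mem_image_of_mem _ (by simpa using hW))
  refine (Set.ncard_le_ncard hsub (Finset.finite_toSet _)).trans ?_
  rw [Set.ncard_coe_finset]
  exact Finset.card_image_le

theorem coord_parabolaPoint_one (e : Module.Basis (Fin 2 ⊕ κ) ℝ E) (t : ℝ) :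
    e.coord (.inl 1) (parabolaPoint e t) = 1 + t ^ 2 := by
  simp [parabolaPoint]

theorem parabolaPoint_ne_neg (e : Module.Basis (Fin 2 ⊕ κ) ℝ E) (s t : ℝ) :
    parabolaPoint e t ≠ -parabolaPoint e s := by
  intro h
  have := congrArg (e.coord (.inl 1)) h
  rw [map_neg, coord_parabolaPoint_one, coord_parabolaPoint_one] at this
  nlinarith [sq_nonneg s, sq_nonneg t]

theorem disjoint_pyramidVertices_opposite
    (e : Module.Basis (Fin 2 ⊕ (Fin k × Bool ⊕ Fin r)) ℝ E) (S T : Finset ℝ) :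
    Disjoint (pyramidVertices e S) (parabolaPoint (oppositeFamily e) '' T) := by
  rw [Set.disjoint_left]
  rintro _ (⟨s, -, rfl⟩ | ⟨j, rfl⟩) ⟨t, -, ht⟩
  · rw [parabolaPoint_oppositeFamily] at ht
    exact parabolaPoint_ne_neg e t s ht.symm
  · rw [parabolaPoint_oppositeFamily] at ht
    have := congrArg (e.coord (.inl 1)) ht
    rw [map_neg, coord_parabolaPoint_one] at this
    simp at this
    nlinarith [sq_nonneg t]

theorem ncard_inter_add_ncard_inter_le
    (e : Module.Basis (Fin 2 ⊕ (Fin k × Bool ⊕ Fin r)) ℝ E) {T : Finset ℝ}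
    (hT : ∀ t ∈ T, 0 ≤ t ∧ t ≤ 1) {W : Set E} (hW : ConvexIndependent ℝ ((↑) : W → E)) {q : E}
    (hqW : q ∈ W) (hqT : q ∈ parabolaPoint (oppositeFamily e) '' T)
    (hq : W ∩ parabolaPoint (oppositeFamily e) '' T ⊆ {q}) :
    (W ∩ pyramidVertices e T).ncard + (W ∩ pyramidVertices (oppositeFamily e) T).ncard ≤
      2 * k + 2 * r + 3 := by
  classical
  have h1 := ncard_inter_pyramidVertices_le e T W
  have h2 := ncard_inter_pyramidVertices_le (oppositeFamily e) T W
  have h3 := card_filter_transverse_le e hW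
  have h4 : (W ∩ parabolaPoint (oppositeFamily e) '' T).ncard ≤ 1 :=
    (Set.ncard_le_ncard hq).trans (Set.ncard_singleton q).le
  have h5 : (W ∩ parabolaPoint e '' T).ncard ≤ 2 := by
    obtain ⟨s, hs, rfl⟩ := hqT
    rw [parabolaPoint_oppositeFamily] at hqW
    have hinj : Function.Injective (parabolaPoint e) := fun s t h => by
      simpa [parabolaPoint, Finsupp.single_apply] using congrArg (e.coord (.inl 0)) h
    refine le_trans ?_ (card_filter_parabolaPoint_le_two hW hT hinj (hT s hs).1 hqW
      fun t => parabolaPoint_ne_neg e s t)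
    have hsub : W ∩ parabolaPoint e '' T ⊆
        ((T.filter fun t => parabolaPoint e t ∈ W).image (parabolaPoint e) : Finset E) := by
      rintro _ ⟨hW, t, ht, rfl⟩
      exact Finset.mem_coe.2 (Finset.mem_image_of_mem _ (Finset.mem_filter.2 ⟨ht, hW⟩))
    refine (Set.ncard_le_ncard hsub (Finset.finite_toSet _)).trans ?_
    rw [Set.ncard_coe_finset]
    exact Finset.card_image_le
  omega

end Construction

/-! ### The lower bound: symmetric differences along a walk. -/

section LowerBound

variable {d n : ℕ}

local notation "𝔼" => EuclideanSpace ℝ (Fin d)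

theorem ncard_symmDiff_add {α : Type*} {s t : Set α} (hs : s.Finite) (ht : t.Finite) :
    (s ∆ t).ncard + 2 * (s ∩ t).ncard = s.ncard + t.ncard := by
  have h1 := Set.ncard_inter_add_ncard_sdiff_eq_ncard s t hs
  have h2 := Set.ncard_inter_add_ncard_sdiff_eq_ncard t s ht
  rw [Set.symmDiff_def, Set.ncard_union_eq disjoint_sdiff_sdiff hs.sdiff ht.sdiff]
  rw [Set.inter_comm] at h2
  omega

theorem ncard_symmDiff_triangle {α : Type*} {s t u : Set α} (hs : s.Finite) (ht : t.Finite)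
    (hu : u.Finite) : (s ∆ u).ncard ≤ (s ∆ t).ncard + (t ∆ u).ncard :=
  (Set.ncard_le_ncard (symmDiff_triangle s t u) ((hs.symmDiff ht).union (ht.symmDiff hu))).trans
    (Set.ncard_union_le _ _)

theorem ncard_symmDiff_insert {α : Type*} {s : Set α} {x : α} (hx : x ∉ s) :
    (s ∆ insert x s).ncard = 1 := by
  have : s ∆ insert x s = {x} := by
    ext y
    by_cases hy : y = x <;> simp [Set.mem_symmDiff, hy, hx]
  rw [this, Set.ncard_singleton]

theorem ncard_symmDiff_vertices_le_one {P Q : Polytope d} (h : (Gamma d).Adj P Q) :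
    (P.vertices ∆ Q.vertices).ncard ≤ 1 := by
  rcases vertices_eq_insert_of_gamma_adj h with ⟨x, hx, hQ⟩ | ⟨x, hx, hP⟩
  · rw [hQ, ncard_symmDiff_insert hx]
  · rw [hP, symmDiff_comm, ncard_symmDiff_insert hx]

theorem ncard_symmDiff_vertices_le_length {P Q : level d n} (p : (GammaLevel d n).Walk P Q) :
    (P.1.vertices ∆ Q.1.vertices).ncard ≤ p.length := by
  induction p with
  | nil => simp
  | @cons P R Q h p ih =>
    have h1 := ncard_symmDiff_vertices_le_one (SimpleGraph.induce_adj.1 h)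
    have h2 := ncard_symmDiff_triangle P.1.finite_vertices R.1.finite_vertices Q.1.finite_vertices
    rw [SimpleGraph.Walk.length_cons]
    omega

/-- On a walk that reaches a set `S` of points, there is a first polytope with a vertex in `S`;
it has been obtained by inserting that vertex. -/
theorem exists_first_vertex_mem {P Q : level d n} (p : (GammaLevel d n).Walk P Q) {S : Set 𝔼}
    (hP : Disjoint P.1.vertices S) (hQ : ¬Disjoint Q.1.vertices S) :
    ∃ R : level d n, R.1.numVertices = n + 1 ∧
      (∃ q ∈ R.1.vertices, q ∈ S ∧ R.1.vertices ∩ S ⊆ {q}) ∧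
      (P.1.vertices ∆ R.1.vertices).ncard + (R.1.vertices ∆ Q.1.vertices).ncard ≤ p.length := by
  induction p with
  | nil => exact absurd hP hQ
  | @cons P R Q h p ih =>
    have hadj := SimpleGraph.induce_adj.1 h
    have h1 := ncard_symmDiff_vertices_le_one hadj
    rw [SimpleGraph.Walk.length_cons]
    by_cases hR : Disjoint R.1.vertices S
    · obtain ⟨Z, hZ, hq, hle⟩ := ih hR hQ
      refine ⟨Z, hZ, hq, ?_⟩
      have h2 := ncard_symmDiff_triangle P.1.finite_vertices R.1.finite_vertices
        Z.1.finite_vertices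
      omega
    · have h2 := ncard_symmDiff_vertices_le_length p
      rcases vertices_eq_insert_of_gamma_adj hadj with ⟨x, hx, hRx⟩ | ⟨x, hx, hPx⟩
      · have hRn : R.1.numVertices = P.1.numVertices + 1 := by
          rw [Polytope.numVertices, hRx, Set.ncard_insert_of_notMem hx P.1.finite_vertices,
            Polytope.numVertices]
        refine ⟨R, ?_, ⟨x, ?_, ?_, ?_⟩, by omega⟩
        · have hP2 : P.1.numVertices = n ∨ P.1.numVertices = n + 1 := P.2
          have hR2 : R.1.numVertices = n ∨ R.1.numVertices = n + 1 := R.2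
          omega
        · rw [hRx]
          exact Set.mem_insert _ _
        · by_contra hxS
          refine hR ?_
          rw [hRx, Set.disjoint_insert_left]
          exact ⟨hxS, hP⟩
        · rw [hRx]
          rintro z ⟨rfl | hz, hzS⟩
          · rfl
          · exact absurd hzS (Set.disjoint_left.1 hP hz)
      -- A deletion cannot create a first vertex in `S`.
      · refine absurd (hP.mono_left ?_) hR
        rw [hPx]
        exact Set.subset_insert _ _

theorem exists_le_edist (hd : 2 ≤ d) (hn : d + 1 ≤ n) :
    ∃ P Q : level d n, ((4 * n - 2 * d : ℕ) : ℕ∞) ≤ (GammaLevel d n).edist P Q := by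
  -- The d - 2 transverse vectors are paired, with one left over when d is odd.
  obtain ⟨k, r, hr, hkr⟩ : ∃ k r : ℕ, r ≤ 1 ∧ d = 2 + (2 * k + r) :=
    ⟨(d - 2) / 2, (d - 2) % 2, by omega, by omega⟩
  have hκ : Fintype.card (Fin k × Bool ⊕ Fin r) = 2 * k + r := by
    simp [mul_comm]
  let e : Module.Basis (Fin 2 ⊕ (Fin k × Bool ⊕ Fin r)) ℝ 𝔼 :=
    (EuclideanSpace.basisFun (Fin d) ℝ).toBasis.reindex (Fintype.equivOfCardEq (by
      rw [Fintype.card_sum, hκ, Fintype.card_fin, Fintype.card_fin, hkr]))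
  obtain ⟨T, hT, hTcard⟩ := (Set.Icc_infinite (zero_lt_one (α := ℝ))).exists_subset_card_eq
    (n + 3 - d)
  have hT3 : 2 < T.card := by omega
  have hpoly : ∀ f : Module.Basis (Fin 2 ⊕ (Fin k × Bool ⊕ Fin r)) ℝ 𝔼,
      ∃ P : level d n, P.1.vertices = pyramidVertices f T ∧ P.1.numVertices = n + 1 := by
    intro f
    obtain ⟨P, hP⟩ := exists_polytope_vertices_eq (finite_pyramidVertices f T)
      (convexIndependent_pyramidVertices f T) (affineSpan_pyramidVertices f hT3)
    have hPn : P.numVertices = n + 1 := by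
      rw [Polytope.numVertices, hP, ncard_pyramidVertices, hκ, hTcard]
      omega
    exact ⟨⟨P, Or.inr hPn⟩, hP, hPn⟩
  obtain ⟨P, hP, hPn⟩ := hpoly e
  obtain ⟨Q, hQ, hQn⟩ := hpoly (oppositeBasis e)
  rw [coe_oppositeBasis] at hQ
  refine ⟨P, Q, ?_⟩
  rw [SimpleGraph.edist_eq_sInf]
  refine le_sInf ?_
  rintro _ ⟨p, rfl⟩
  obtain ⟨R, hRn, ⟨q, hqR, hqS, hq⟩, hle⟩ := exists_first_vertex_mem p
    (S := parabolaPoint (oppositeFamily e) '' T)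
    (hP ▸ disjoint_pyramidVertices_opposite e T T) (by
      obtain ⟨t, ht⟩ := Finset.card_pos.1 (show 0 < T.card by omega)
      rw [hQ, Set.not_disjoint_iff]
      exact ⟨_, Or.inl ⟨t, ht, rfl⟩, t, ht, rfl⟩)
  have hcount := ncard_inter_add_ncard_inter_le e (fun t ht => hT ht)
    R.1.convexIndependent_vertices hqR hqS hq
  have h1 := ncard_symmDiff_add R.1.finite_vertices P.1.finite_vertices
  have h2 := ncard_symmDiff_add R.1.finite_vertices Q.1.finite_vertices
  rw [← hP, ← hQ] at hcount
  rw [symmDiff_comm] at hle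
  simp only [Polytope.numVertices] at hPn hQn hRn
  -- The length is at least 4(n + 1) - 2(2k + 2r + 3) = 4n - 2d + 2 - 2r, and r ≤ 1.
  have : 4 * n - 2 * d ≤ p.length := by omega
  exact Nat.cast_le.2 this

end LowerBound

end PolytopeGraph

theorem theorem1 (d n : ℕ) (hd : 2 ≤ d) (hn : d + 1 ≤ n) :
    (PolytopeGraph.GammaLevel d n).Connected ∧
    ((4 * n - 2 * d : ℕ) : ℕ∞) ≤ (PolytopeGraph.GammaLevel d n).ediam ∧
    (PolytopeGraph.GammaLevel d n).ediam ≤ ((6 * n - 2 : ℕ) : ℕ∞) ∧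
    (∀ P Q : PolytopeGraph.level d n, P.1.numVertices = n → Q.1.numVertices = n →
      (PolytopeGraph.GammaLevel d n).edist P Q ≤ ((6 * n - 4 : ℕ) : ℕ∞)) := by
  obtain ⟨P, Q, hPQ⟩ := PolytopeGraph.exists_le_edist hd hn
  refine ⟨?_, hPQ.trans SimpleGraph.edist_le_ediam,
    SimpleGraph.ediam_le_of_edist_le (PolytopeGraph.edist_le hd hn),
    PolytopeGraph.edist_le_of_numVertices_eq hd hn⟩
  have : Nonempty (PolytopeGraph.level d n) := ⟨P⟩
  refine SimpleGraph.connected_iff_exists_forall_reachable _ |>.2 ⟨P, fun R => ?_⟩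
  exact SimpleGraph.reachable_of_edist_ne_top
    ((PolytopeGraph.edist_le hd hn P R).trans_lt (ENat.natCast_lt_top _)).ne
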